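/- Let $\mathcal F$ be a signature, $\mathcal V$ an infinite set of variables, and $\mathcal R$ a term rewrite system (TRS), i.e. an arbitrary (possibly infinite) set of rules $l \to r$ between terms over $\mathcal F$ and $\mathcal V$; no variable conditions are imposed. A rewrite step $s \to^{\pi} t$ of $\mathcal R$ with redex pattern $\pi = \langle p, l \to r, \sigma\rangle$, $l\to r \in \mathcal R$, satisfies $s|_p = l\sigma$ and $t = s[r\sigma]_p$; read backwards it is written $t \mathrel{{}^{\pi}{\leftarrow}} s$. A conversion $\leftrightarrow^*$ is a finite sequence of steps read forwards or backwards, and $\to^=$ denotes at most one step. Let $>$ be a well-founded (strict) order and $\geqslant$ a preorder on a set of labels such that ${\geqslant}\cdot{>}\cdot{\geqslant} \subseteq {>}$. A *labeling* is a function $\ell$ from rewrite steps of $\mathcal R$ (read in either direction) to labels such that $\ell(s \to^\pi t) = \ell(t \mathrel{{}^{\pi}{\leftarrow}} s)$ and, for all contexts $C$ (with hole at position $q$), all substitutions $\tau$, and both relations $\succcurlyeq\ \in \{>, \geqslant\}$, $\ell(s \to^{\pi_1} t) \succcurlyeq \ell(u \to^{\pi_2} v)$ implies $\ell(C[s\tau]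 \to^{C[\pi_1\tau]} C[t\tau]) \succcurlyeq \ell(C[u\tau] \to^{C[\pi_2\tau]} C[v\tau])$, where $C[\pi\tau] = \langle qp, l\to r, \sigma\tau\rangle$ for $\pi = \langle p, l \to r, \sigma\rangle$. For a conversion, let $\ell(\cdot)$ be the set of labels of its steps. A local peak $t \mathrel{{}^{\pi_1}{\leftarrow}} s \to^{\pi_2} u$ with labels $\alpha = \ell(t \leftarrow s)$ and $\beta = \ell(s \to u)$ is *extended locally decreasing* (for $\ell$, $>$, $\geqslant$) if there are $t \leftrightarrow^* t' \to^= t'' \leftrightarrow^* u'' \mathrel{{}^{=}{\leftarrow}} u' \leftrightarrow^* u$ such that all labels of $t \leftrightarrow^* t'$ are $< \alpha$, the label of $t' \to^= t''$ (if any) is $\leqslant \beta$, all labels of $t'' \leftrightarrow^* u''$ are $< \alpha$ or $< \beta$, the label of $u'' \mathrel{{}^{=}{\leftarrow}} u'$ (if any) is $\leqslant \alpha$, and all labels of $u' \leftrightarrow^* u$ are $< \beta$. A local peak $t \leftarrow s \to u$ whose left step is at position $p$ and whose right step is at position $q$ with rule $l_2 \to r_2$ is a *parallel peak* if $p$ and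 $q$ are incomparable in the prefix order, and a *variable peak* if $p = qq'$ for some $q'$ that is not a function symbol position of $l_2$. The labeling $\ell$ is *compatible* with $\mathcal R$ if all parallel peaks and all variable peaks of $\mathcal R$ are extended locally decreasing. A *critical peak* is a local peak $l_2\mu[r_1\mu]_p \leftarrow l_2\mu \to r_2\mu$, with steps at position $p$ and at the root respectively, where $l_1 \to r_1$ and $l_2 \to r_2$ are variants of rules of $\mathcal R$ without common variables, $p$ is a function symbol position of $l_2$, and $\mu$ is a most general unifier of $l_1$ and $l_2|_p$; root overlaps of a rule with a variant of itself are not excluded. Here the variants are images of rules of $\mathcal R$ under injective maps $\rho_1, \rho_2 : \mathcal V \to \mathcal V$ with disjoint ranges, and as steps of $\mathcal R$ the two steps use the original rules with the substitutions $x \mapsto (\rho_1 x)\mu$ and $x \mapsto (\rho_2 x)\mu$. **Corollary.** Let $\ell$ be a labeling that is compatible with $\mathcal R$. If all critical peaks of $\mathcal R$ are extended locally decreasing for $\ell$, $>$ and $\geqslant$, then $\mathcal R$ is confluent, i.e. whenever $s \to_{\mathcal R}^* t$ and $s \to_{\mathcal R}^* u$ there is $v$ with $t \to_{\mathcal R}^*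 v$ and $u \to_{\mathcal R}^* v$. -/

import Mathlib

universe u v w x

namespace Rewriting

open FirstOrder.Language

/-! ### Terms, positions, substitutions, contexts

Terms over a signature `L` and variables `V` are Mathlib's first-order terms `L.Term V` (the relation
symbols of `L` play no role), and `t.subst σ` is the application of a substitution.
Positions are finite strings of numbers; arguments are numbered from `0`. -/

/-- `subtermAt t p` is the subterm of `t` at position `p`, or `none` if `p` is not a position
of `t`. -/
def subtermAt {L : FirstOrder.Language.{u, v}} {V : Type w} : L.Term V → List ℕ → Option (L.Term V)
  | t, [] => some t
  | .var _, _ :: _ => none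
  | @Term.func _ _ l _ ts, i :: p => if h : i < l then subtermAt (ts ⟨i, h⟩) p else none

/-- `replaceAt t p u` is the term `t[u]_p` (only used when `p` is a position of `t`). -/
def replaceAt {L : FirstOrder.Language.{u, v}} {V : Type w} : L.Term V → List ℕ → L.Term V → L.Term V
  | _, [], u => u
  | .var y, _ :: _, _ => .var y
  | .func f ts, i :: p, u =>
      .func f (fun j => if (j : ℕ) = i then replaceAt (ts j) p u else ts j)

/-- `p` is a function symbol position of `t`. -/
def IsFunPos {L : FirstOrder.Language.{u, v}} {V : Type w} (t : L.Term V) (p : List ℕ) : Prop :=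
  ∃ (l : ℕ) (f : L.Functions l) (ts : Fin l → L.Term V), subtermAt t p = some (.func f ts)

/-- The composition of substitutions: first `σ`, then `τ`. -/
def substComp {L : FirstOrder.Language.{u, v}} {V : Type w} (σ τ : V → L.Term V) : V → L.Term V :=
  fun y => (σ y).subst τ

/-- Contexts: terms with exactly one hole. In `func f ts i C` the hole is inside the `i`-th argument,
which is `C`; the entry `ts i` is disregarded. -/
inductive Ctx (L : FirstOrder.Language.{u, v}) (V : Type w) : Type (max u w)
  | hole : Ctx L V
  | func {l : ℕ} (f : L.Functions l) (ts : Fin l → L.Term V) (i : Fin l) (C : Ctx L V) : Ctx L V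

/-- `C.fill t` is `C[t]`. -/
def Ctx.fill {L : FirstOrder.Language.{u, v}} {V : Type w} : Ctx L V → L.Term V → L.Term V
  | .hole, t => t
  | .func f ts i C, t => .func f (Function.update ts i (C.fill t))

/-- The position of the hole. -/
def Ctx.holePos {L : FirstOrder.Language.{u, v}} {V : Type w} : Ctx L V → List ℕ
  | .hole => []
  | .func _ _ i C => (i : ℕ) :: C.holePos

theorem subst_subst {L : FirstOrder.Language.{u, v}} {V : Type w} (t : L.Term V) (σ τ : V → L.Term V) :
    (t.subst σ).subst τ = t.subst (substComp σ τ) := by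
  induction t with
  | var _ => rfl
  | func f ts ih => simp only [Term.subst]; congr 1; funext i; exact ih i

theorem subtermAt_subst {L : FirstOrder.Language.{u, v}} {V : Type w} (σ : V → L.Term V) :
    ∀ (t : L.Term V) (p : List ℕ) (s : L.Term V), subtermAt t p = some s →
      subtermAt (t.subst σ) p = some (s.subst σ)
  | t, [], s, h => by
      have : t = s := by cases t <;> simpa [subtermAt] using h
      subst this
      simp [subtermAt]
  | .var _, _ :: _, _, h => by simp [subtermAt] at h
  | @Term.func _ _ l f ts, i :: p, s, h => by
      by_cases hi : i < l
      · simp only [subtermAt, hi, dif_pos] at h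
        simp only [Term.subst, subtermAt, hi, dif_pos]
        exact subtermAt_subst σ _ p s h
      · simp [subtermAt, hi] at h

theorem replaceAt_subst {L : FirstOrder.Language.{u, v}} {V : Type w} (σ : V → L.Term V) :
    ∀ (t : L.Term V) (p : List ℕ) (r s : L.Term V), subtermAt t p = some s →
      (replaceAt t p r).subst σ = replaceAt (t.subst σ) p (r.subst σ)
  | t, [], r, s, _ => by simp [replaceAt]
  | .var _, _ :: _, _, _, h => by simp [subtermAt] at h
  | @Term.func _ _ l f ts, i :: p, r, s, h => by
      by_cases hi : i < l
      · simp only [subtermAt, hi, dif_pos] at h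
        simp only [Term.subst, replaceAt]
        congr 1
        funext j
        by_cases hj : (j : ℕ) = i
        · have hj' : j = ⟨i, hi⟩ := Fin.ext hj
          subst hj'
          simp only [if_true]
          exact replaceAt_subst σ _ p r s h
        · simp [hj]
      · simp [subtermAt, hi] at h

theorem subtermAt_fill {L : FirstOrder.Language.{u, v}} {V : Type w} (C : Ctx L V) (t : L.Term V)
    (p : List ℕ) : subtermAt (C.fill t) (C.holePos ++ p) = subtermAt t p := by
  induction C with
  | hole => rfl
  | func f ts i C ih => simp [Ctx.fill, Ctx.holePos, subtermAt, ih]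

theorem replaceAt_fill {L : FirstOrder.Language.{u, v}} {V : Type w} (C : Ctx L V) (t r : L.Term V)
    (p : List ℕ) : replaceAt (C.fill t) (C.holePos ++ p) r = C.fill (replaceAt t p r) := by
  induction C with
  | hole => rfl
  | func f ts i C ih =>
      simp only [Ctx.fill, Ctx.holePos, List.cons_append, replaceAt]
      congr 1
      funext j
      by_cases hj : j = i
      · subst hj; simp [ih]
      · have hj' : (j : ℕ) ≠ i := fun h => hj (Fin.ext h)
        simp [hj, hj']

/-! ### Term rewrite systems -/

/-- A rewrite rule is an arbitrary pair of terms; no variable conditions are imposed. A term rewrite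
system is a set of rules. -/
@[ext]
structure Rule (L : FirstOrder.Language.{u, v}) (V : Type w) : Type (max u w) where
  lhs : L.Term V
  rhs : L.Term V

/-- The rewrite relation of `R`: the smallest relation that contains `R` and is closed under
substitutions and contexts. -/
inductive Rewrites {L : FirstOrder.Language.{u, v}} {V : Type w} (R : Set (Rule L V)) :
    L.Term V → L.Term V → Prop
  | rule (ρ : Rule L V) : ρ ∈ R → Rewrites R ρ.lhs ρ.rhs
  | subst (σ : V → L.Term V) {s t : L.Term V} : Rewrites R s t →
      Rewrites R (s.subst σ) (t.subst σ)
  | ctx (C : Ctx L V) {s t : L.Term V} : Rewrites R s t → Rewrites R (C.fill s) (C.fill t)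

/-- Confluence of the term rewrite system `R`. -/
def Confluent {L : FirstOrder.Language.{u, v}} {V : Type w} (R : Set (Rule L V)) : Prop :=
  ∀ s t u : L.Term V, Relation.ReflTransGen (Rewrites R) s t →
    Relation.ReflTransGen (Rewrites R) s u →
    ∃ z, Relation.ReflTransGen (Rewrites R) t z ∧ Relation.ReflTransGen (Rewrites R) u z

/-- A rewrite step of `R`: a source term together with a redex pattern
`⟨pos, rule, sub⟩` that matches it. -/
@[ext]
structure Step {L : FirstOrder.Language.{u, v}} {V : Type w} (R : Set (Rule L V)) : Type (max u w) where
  source : L.Term V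
  pos : List ℕ
  rule : Rule L V
  sub : V → L.Term V
  rule_mem : rule ∈ R
  source_at : subtermAt source pos = some (rule.lhs.subst sub)

/-- The target `s[rσ]_p` of a step. -/
def Step.target {L : FirstOrder.Language.{u, v}} {V : Type w} {R : Set (Rule L V)} (e : Step R) : L.Term V :=
  replaceAt e.source e.pos (e.rule.rhs.subst e.sub)

/-- The instance `C[sσ] → C[tσ]` of the step `s → t`, with redex pattern
`⟨q p, l → r, τσ⟩` where `q` is the position of the hole of `C`. -/
def Step.inst {L : FirstOrder.Language.{u, v}} {V : Type w} {R : Set (Rule L V)} (e : Step R) (C : Ctx L V)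
    (σ : V → L.Term V) : Step R where
  source := C.fill (e.source.subst σ)
  pos := C.holePos ++ e.pos
  rule := e.rule
  sub := substComp e.sub σ
  rule_mem := e.rule_mem
  source_at := by
    rw [subtermAt_fill, subtermAt_subst σ _ _ _ e.source_at, subst_subst]

theorem Step.inst_target {L : FirstOrder.Language.{u, v}} {V : Type w} {R : Set (Rule L V)} (e : Step R)
    (C : Ctx L V) (σ : V → L.Term V) : (e.inst C σ).target = C.fill (e.target.subst σ) := by
  simp only [Step.target, Step.inst]
  rw [replaceAt_fill, replaceAt_subst σ _ _ _ _ e.source_at, subst_subst]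

/-- A rewrite step read in one of the two directions: `s → t` or `t ← s`. -/
inductive OStep {L : FirstOrder.Language.{u, v}} {V : Type w} (R : Set (Rule L V)) : Type (max u w)
  | fwd (e : Step R) : OStep R
  | bwd (e : Step R) : OStep R

def OStep.src {L : FirstOrder.Language.{u, v}} {V : Type w} {R : Set (Rule L V)} : OStep R → L.Term V
  | .fwd e => e.source
  | .bwd e => e.target

def OStep.tgt {L : FirstOrder.Language.{u, v}} {V : Type w} {R : Set (Rule L V)} : OStep R → L.Term V
  | .fwd e => e.target
  | .bwd e => e.source

/-- `IsConversion R s c t`: the list `c` of oriented steps is a conversion from `s` to `t`. -/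
inductive IsConversion {L : FirstOrder.Language.{u, v}} {V : Type w} (R : Set (Rule L V)) :
    L.Term V → List (OStep R) → L.Term V → Prop
  | nil (s : L.Term V) : IsConversion R s [] s
  | cons (o : OStep R) {c : List (OStep R)} {t : L.Term V} :
      IsConversion R o.tgt c t → IsConversion R o.src (o :: c) t

/-- A list with at most one element that is a forward rewrite sequence from `s` to `t`
(a step of the reflexive closure of the rewrite relation). -/
def IsForwardOpt {L : FirstOrder.Language.{u, v}} {V : Type w} (R : Set (Rule L V))
    (s : L.Term V) (c : List (OStep R)) (t : L.Term V) : Prop :=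
  (c = [] ∧ s = t) ∨ ∃ e : Step R, c = [.fwd e] ∧ e.source = s ∧ e.target = t

/-- The same for a backward step from `s` to `t`, i.e. `s ← t`. -/
def IsBackwardOpt {L : FirstOrder.Language.{u, v}} {V : Type w} (R : Set (Rule L V))
    (s : L.Term V) (c : List (OStep R)) (t : L.Term V) : Prop :=
  (c = [] ∧ s = t) ∨ ∃ e : Step R, c = [.bwd e] ∧ e.target = s ∧ e.source = t

/-! ### Local peaks -/

/-- A local peak `t ← s → u`: two steps with the same source, `left : s → t` and
`right : s → u`. -/
structure LocalPeak {L : FirstOrder.Language.{u, v}} {V : Type w} (R : Set (Rule L V)) :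
    Type (max u w) where
  left : Step R
  right : Step R
  source_eq : left.source = right.source

/-- The two positions are incomparable in the prefix order. -/
def LocalPeak.IsParallel {L : FirstOrder.Language.{u, v}} {V : Type w} {R : Set (Rule L V)}
    (P : LocalPeak R) : Prop :=
  ¬ P.left.pos <+: P.right.pos ∧ ¬ P.right.pos <+: P.left.pos

/-- The left step takes place at or below the position of the right step, but not at a
function symbol position of the left-hand side of the rule of the right step. -/
def LocalPeak.IsVariable {L : FirstOrder.Language.{u, v}} {V : Type w} {R : Set (Rule L V)}
    (P : LocalPeak R) : Prop :=
  ∃ q : List ℕ, P.left.pos = P.right.pos ++ q ∧ ¬ IsFunPos P.right.rule.lhs q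

/-- `μ` is a most general unifier of `s` and `t`. -/
def IsMGU {L : FirstOrder.Language.{u, v}} {V : Type w} (μ : V → L.Term V) (s t : L.Term V) : Prop :=
  s.subst μ = t.subst μ ∧
    ∀ τ : V → L.Term V, s.subst τ = t.subst τ → ∃ θ : V → L.Term V, τ = substComp μ θ

/-- Critical peaks `l₂μ[r₁μ]_p ← l₂μ → r₂μ` of `R`. The variants without common variables of the
two rules are their images under injective renamings `ρ₁`, `ρ₂` with disjoint ranges, `p` is a
function symbol position of `l₂`, and `μ` is a most general unifier of the renamed `l₁` and the
subterm at `p` of the renamed `l₂`. As steps of `R`, the left step applies the first rule at `p` with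
the substitution `y ↦ μ (ρ₁ y)`, and the right step the second rule at the root with
`y ↦ μ (ρ₂ y)`. Overlaps of a rule with itself at the root are not excluded. -/
def LocalPeak.IsCritical {L : FirstOrder.Language.{u, v}} {V : Type w} {R : Set (Rule L V)}
    (P : LocalPeak R) : Prop :=
  ∃ (ρ₁ ρ₂ : V → V) (μ : V → L.Term V) (s : L.Term V),
    Function.Injective ρ₁ ∧ Function.Injective ρ₂ ∧
    Disjoint (Set.range ρ₁) (Set.range ρ₂) ∧
    IsFunPos P.right.rule.lhs P.left.pos ∧
    subtermAt (P.right.rule.lhs.relabel ρ₂) P.left.pos = some s ∧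
    IsMGU μ (P.left.rule.lhs.relabel ρ₁) s ∧
    P.right.pos = [] ∧
    P.left.sub = (fun y => μ (ρ₁ y)) ∧ P.right.sub = (fun y => μ (ρ₂ y))

/-! ### Labelings and extended local decreasingness -/

/-- A labeling (for the relations `gt` and `ge` on labels): a function from oriented rewrite steps to
labels that ignores the direction, such that `gt` and `ge` between labels of steps are preserved
by contexts and substitutions. -/
structure IsLabeling {L : FirstOrder.Language.{u, v}} {V : Type w} {R : Set (Rule L V)} {Λ : Type x}
    (gt ge : Λ → Λ → Prop) (lab : OStep R → Λ) : Prop where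
  gt_inst : ∀ (e₁ e₂ : Step R) (C : Ctx L V) (σ : V → L.Term V),
    gt (lab (.fwd e₁)) (lab (.fwd e₂)) →
      gt (lab (.fwd (e₁.inst C σ))) (lab (.fwd (e₂.inst C σ)))
  ge_inst : ∀ (e₁ e₂ : Step R) (C : Ctx L V) (σ : V → L.Term V),
    ge (lab (.fwd e₁)) (lab (.fwd e₂)) →
      ge (lab (.fwd (e₁.inst C σ))) (lab (.fwd (e₂.inst C σ)))
  fwd_eq_bwd : ∀ e : Step R, lab (.fwd e) = lab (.bwd e)

/-- The set of labels of a conversion. -/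
def labels {L : FirstOrder.Language.{u, v}} {V : Type w} {R : Set (Rule L V)} {Λ : Type x}
    (lab : OStep R → Λ) (c : List (OStep R)) : Set Λ :=
  {α | ∃ o ∈ c, lab o = α}

/-- The set of all `β` with `α ≻ β` for some `α ∈ S`. -/
def below {Λ : Type x} (r : Λ → Λ → Prop) (S : Set Λ) : Set Λ :=
  {β | ∃ α ∈ S, r α β}

/-- The local peak `t ← s → u` is extended locally decreasing: there is a local diagram
`t ↔* t' →⁼ t'' ↔* u'' ←⁼ u' ↔* u` with suitably bounded labels. -/
def LocalPeak.IsELD {L : FirstOrder.Language.{u, v}} {V : Type w} {R : Set (Rule L V)} {Λ : Type x}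
    (gt ge : Λ → Λ → Prop) (lab : OStep R → Λ) (P : LocalPeak R) : Prop :=
  ∃ (t' t'' u'' u' : L.Term V) (c₁ c₂ c₃ c₄ c₅ : List (OStep R)),
    IsConversion R P.left.target c₁ t' ∧
    IsForwardOpt R t' c₂ t'' ∧
    IsConversion R t'' c₃ u'' ∧
    IsBackwardOpt R u'' c₄ u' ∧
    IsConversion R u' c₅ P.right.target ∧
    labels lab c₁ ⊆ below gt (labels lab [.bwd P.left]) ∧
    labels lab c₂ ⊆ below ge (labels lab [.fwd P.right]) ∧
    labels lab c₃ ⊆ below gt (labels lab [.bwd P.left, .fwd P.right]) ∧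
    labels lab c₄ ⊆ below ge (labels lab [.bwd P.left]) ∧
    labels lab c₅ ⊆ below gt (labels lab [.fwd P.right])

/-- The labeling `lab` is compatible with `R`: all parallel peaks and all variable peaks of `R` are
extended locally decreasing. -/
def IsCompatible {L : FirstOrder.Language.{u, v}} {V : Type w} {R : Set (Rule L V)} {Λ : Type x}
    (gt ge : Λ → Λ → Prop) (lab : OStep R → Λ) : Prop :=
  ∀ P : LocalPeak R, P.IsParallel ∨ P.IsVariable → P.IsELD gt ge lab

end Rewriting

/-! Labels are replaced by their ordinal ranks with respect to `>`; since `≥ · >` is contained in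
`>`, the rank is monotone for `≥`, and extended local decreasingness is preserved. It is also
preserved by contexts and substitutions. If one of the two positions of a local peak is a prefix of
the other, then the peak or its mirror image is a variable peak or an instance of a critical peak;
otherwise it is a parallel peak. So every local peak has a decreasing diagram, read from one of its
two sides.

That local decreasingness implies confluence is proved by induction on a bound `c` for the indices
of a conversion between two points `x` and `y`: steps with index at least `c` from `x` and from `y`
can be projected to steps with the same bounds from a common reduct of `x` and `y`. If `b` is the
largest index in the conversion, then by the induction hypothesis for `b` the `b`-steps, taken
modulo convertibility below `b`, have the diamond property, hence `x` and `y` have a common reduct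
`v` for this relation. The given steps are carried along the two reductions to `v`, and the
induction hypothesis for `b` is applied again where these meet. -/

namespace Rewriting

section AbstractRewriting

open Relation

variable {A : Type*} {O : Type*} [LinearOrder O] {r : O → A → A → Prop}

/-- One step with index below `c`, for a family `r` of relations indexed by a linear order. -/
def StepBelow (r : O → A → A → Prop) (c : O) (x y : A) : Prop :=
  ∃ d < c, r d x y

/-- Reachability by steps with index below `c`. -/
def RedBelow (r : O → A → A → Prop) (c : O) : A → A → Prop :=
  ReflTransGen (StepBelow r c)

/-- Convertibility by steps with index below `c`. -/
def ConvBelow (r : O → A → A → Prop) (c : O) : A → A → Prop :=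
  EqvGen (StepBelow r c)

/-- The points `t` and `u` are connected by a decreasing diagram, where `t` has been reached by a
step with index `a` and `u` by a step with index `b`. -/
def DecreasingJoin (r : O → A → A → Prop) (a b : O) (t u : A) : Prop :=
  ∃ t' t'' u'' u', ConvBelow r a t t' ∧ ReflGen (r b) t' t'' ∧ ConvBelow r (max a b) t'' u'' ∧
    ReflGen (r a) u' u'' ∧ ConvBelow r b u' u

/-- Local decreasingness of an indexed family of relations, in its version with conversions. -/
def LocallyDecreasing (r : O → A → A → Prop) : Prop :=
  ∀ a b s t u, r a s t → r b s u → DecreasingJoin r a b t u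

/-- At most one step with index `c`, followed by a conversion with indices below `c`. -/
def StepThenConv (r : O → A → A → Prop) (c : O) (x y : A) : Prop :=
  ∃ y', ReflGen (r c) x y' ∧ ConvBelow r c y' y

/-- At most one step with index `c`, modulo convertibility below `c` on both sides. -/
def StepModulo (r : O → A → A → Prop) (c : O) (x y : A) : Prop :=
  ∃ x', ConvBelow r c x x' ∧ StepThenConv r c x' y

/-- Steps with indices at least `c` that start at two points convertible below `c` can be projected
to a common reduct of these points. This is the induction invariant in the proof that local
decreasingness implies confluence. -/
def Projects (r : O → A → A → Prop) (c : O) : Prop :=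
  ∀ a b, c ≤ a → c ≤ b → ∀ x y t u, ConvBelow r c x y → StepThenConv r a x t →
    StepThenConv r b y u →
    ∃ z, RedBelow r c x z ∧ RedBelow r c y z ∧ StepThenConv r a z t ∧ StepThenConv r b z u

theorem StepBelow.mono {c d : O} (hcd : c ≤ d) : StepBelow r c ≤ StepBelow r d :=
  fun _ _ ⟨e, hec, h⟩ => ⟨e, hec.trans_le hcd, h⟩

theorem RedBelow.mono {c d : O} (hcd : c ≤ d) {x y : A} (h : RedBelow r c x y) :
    RedBelow r d x y :=
  ReflTransGen.mono (StepBelow.mono hcd) _ _ h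

theorem RedBelow.convBelow {c : O} {x y : A} (h : RedBelow r c x y) : ConvBelow r c x y :=
  EqvGen.reflTransGen_le_eqvGen _ _ _ h

namespace ConvBelow

theorem refl {c : O} (x : A) : ConvBelow r c x x :=
  EqvGen.refl x

theorem symm {c : O} {x y : A} (h : ConvBelow r c x y) : ConvBelow r c y x :=
  EqvGen.symm _ _ h

theorem trans {c : O} {x y z : A} (hxy : ConvBelow r c x y) (hyz : ConvBelow r c y z) :
    ConvBelow r c x z :=
  EqvGen.trans _ _ _ hxy hyz

theorem mono {c d : O} (hcd : c ≤ d) {x y : A} (h : ConvBelow r c x y) : ConvBelow r d x y :=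
  EqvGen.mono (StepBelow.mono hcd) _ _ h

theorem of_reflGen {c d : O} (hcd : c < d) {x y : A} (h : ReflGen (r c) x y) :
    ConvBelow r d x y := by
  cases h with
  | refl => exact .refl x
  | single h => exact .rel _ _ ⟨c, hcd, h⟩

end ConvBelow

theorem DecreasingJoin.symm {a b : O} {t u : A} (h : DecreasingJoin r a b t u) :
    DecreasingJoin r b a u t := by
  obtain ⟨t', t'', u'', u', ht, ht', hmid, hu', hu⟩ := h
  exact ⟨u', u'', t'', t', hu.symm, hu', max_comm a b ▸ hmid.symm, ht', ht.symm⟩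

theorem StepThenConv.refl {c : O} (x : A) : StepThenConv r c x x :=
  ⟨x, .refl, .refl x⟩

theorem StepModulo.of_step_le {b d : O} (hdb : d ≤ b) {x y : A} (h : r d x y) :
    StepModulo r b x y := by
  rcases hdb.eq_or_lt with rfl | hdb
  · exact ⟨x, .refl x, y, .single h, .refl y⟩
  · exact ⟨y, .rel _ _ ⟨d, hdb, h⟩, .refl y⟩

theorem LocallyDecreasing.exists_convBelow_stepThenConv (hr : LocallyDecreasing r) {b c : O}
    (hbc : b < c) {z t y : A} (ht : StepThenConv r c z t) (hy : StepThenConv r b z y) :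
    ∃ p, ConvBelow r b y p ∧ StepThenConv r c p t := by
  obtain ⟨t₁, hzt₁, ht₁⟩ := ht
  obtain ⟨y₁, hzy₁, hy₁⟩ := hy
  cases hzt₁ with
  | refl =>
    exact ⟨y, .refl y, y, .refl,
      ((hy₁.mono hbc.le).symm.trans (ConvBelow.of_reflGen hbc hzy₁).symm).trans ht₁⟩
  | single hzt₁ =>
    cases hzy₁ with
    | refl => exact ⟨z, hy₁.symm, t₁, .single hzt₁, ht₁⟩
    | single hzy₁ =>
      obtain ⟨t', t'', p', p, ht', ht'', hmid, hp, hyp⟩ := hr _ _ _ _ _ hzt₁ hzy₁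
      rw [max_eq_left hbc.le] at hmid
      exact ⟨p, hy₁.symm.trans hyp.symm, p', hp,
        ((ht'.trans (.of_reflGen hbc ht'')).trans hmid).symm.trans ht₁⟩

theorem LocallyDecreasing.exists_stepModulo (hr : LocallyDecreasing r) {b : O} {z t u : A}
    (ht : StepThenConv r b z t) (hu : StepThenConv r b z u) :
    ∃ w, StepModulo r b t w ∧ StepModulo r b u w := by
  obtain ⟨t₁, hzt₁, ht₁⟩ := ht
  obtain ⟨u₁, hzu₁, hu₁⟩ := hu
  cases hzt₁ with
  | refl => exact ⟨u₁, ⟨z, ht₁.symm, u₁, hzu₁, .refl u₁⟩, u₁, hu₁.symm, .refl u₁⟩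
  | single hzt₁ =>
    cases hzu₁ with
    | refl => exact ⟨t₁, ⟨t₁, ht₁.symm, .refl t₁⟩, z, hu₁.symm, t₁, .single hzt₁, .refl t₁⟩
    | single hzu₁ =>
      obtain ⟨t', t'', u'', u', ht', ht'', hmid, hu', hu⟩ := hr _ _ _ _ _ hzt₁ hzu₁
      rw [max_self] at hmid
      exact ⟨u'', ⟨t', ht₁.symm.trans ht', t'', ht'', hmid⟩,
        u', hu₁.symm.trans hu.symm, u'', hu', .refl u''⟩

namespace Projects

variable {b : O}

theorem stepModulo_diamond (hb : Projects r b) (hr : LocallyDecreasing r) {x t u : A}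
    (ht : StepModulo r b x t) (hu : StepModulo r b x u) :
    ∃ w, StepModulo r b t w ∧ StepModulo r b u w := by
  obtain ⟨x₁, hx₁, ht⟩ := ht
  obtain ⟨x₂, hx₂, hu⟩ := hu
  obtain ⟨z, -, -, ht, hu⟩ := hb b b le_rfl le_rfl x₁ x₂ t u (hx₁.symm.trans hx₂) ht hu
  exact hr.exists_stepModulo ht hu

theorem join_stepModulo (hb : Projects r b) (hr : LocallyDecreasing r) {x y : A}
    (h : EqvGen (fun x y => ∃ d ≤ b, r d x y) x y) : Join (ReflTransGen (StepModulo r b)) x y := by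
  have hequiv : Equivalence (Join (ReflTransGen (StepModulo r b))) :=
    equivalence_join_reflTransGen fun _ _ _ ht hu =>
      (hb.stepModulo_diamond hr ht hu).imp fun _ hw => ⟨.single hw.1, .single hw.2⟩
  refine hequiv.eqvGen_iff.1 (EqvGen.mono ?_ _ _ h)
  rintro x y ⟨d, hdb, hxy⟩
  exact ⟨y, .single (.of_step_le hdb hxy), .refl⟩

theorem along_stepModulo (hb : Projects r b) (hr : LocallyDecreasing r) {c a : O} (hbc : b < c)
    (hca : c ≤ a) {x y t : A} (hxy : StepModulo r b x y) (ht : StepThenConv r a x t) :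
    ∃ w, RedBelow r c x w ∧ ConvBelow r b w y ∧ StepThenConv r a w t := by
  have hba : b < a := hbc.trans_le hca
  obtain ⟨x', hx', hy⟩ := hxy
  obtain ⟨z, hxz, -, hzt, y₁, hzy₁, hy₁⟩ := hb a b hba.le le_rfl x x' t y hx' ht hy
  obtain ⟨p, hp, hpt⟩ := hr.exists_convBelow_stepThenConv hba hzt ⟨y₁, hzy₁, .refl y₁⟩
  obtain ⟨w, hy₁w, -, -, hwt⟩ := hb b a le_rfl hba.le y₁ p y₁ t hp (.refl y₁) hpt
  have hzy₁' : RedBelow r c z y₁ := ReflGen.to_reflTransGen (hzy₁.mono fun _ _ h => ⟨b, hbc, h⟩)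
  exact ⟨w, ((hxz.mono hbc.le).trans hzy₁').trans (hy₁w.mono hbc.le),
    hy₁w.convBelow.symm.trans hy₁, hwt⟩

theorem along_reflTransGen_stepModulo (hb : Projects r b) (hr : LocallyDecreasing r) {c a : O}
    (hbc : b < c) (hca : c ≤ a) {x y t : A} (hxy : ReflTransGen (StepModulo r b) x y)
    (ht : StepThenConv r a x t) :
    ∃ w, RedBelow r c x w ∧ ConvBelow r b w y ∧ StepThenConv r a w t := by
  induction hxy with
  | refl => exact ⟨x, .refl, .refl x, ht⟩
  | tail _ hyy' ih =>
    obtain ⟨w, hxw, hwy, hwt⟩ := ih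
    obtain ⟨y₁, hyy₁, hy₁⟩ := hyy'
    obtain ⟨w', hww', hw', hwt'⟩ := hb.along_stepModulo hr hbc hca ⟨y₁, hwy.trans hyy₁, hy₁⟩ hwt
    exact ⟨w', hxw.trans hww', hw', hwt'⟩

end Projects

theorem eq_or_exists_eqvGen_le {p : O → Prop} {x y : A}
    (h : EqvGen (fun x y => ∃ d, p d ∧ r d x y) x y) :
    x = y ∨ ∃ b, p b ∧ EqvGen (fun x y => ∃ d ≤ b, r d x y) x y := by
  have mono : ∀ {b b'}, b ≤ b' →
      EqvGen (fun x y => ∃ d ≤ b, r d x y) ≤ EqvGen (fun x y => ∃ d ≤ b', r d x y) :=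
    fun hbb' => EqvGen.mono fun _ _ ⟨d, hdb, h⟩ => ⟨d, hdb.trans hbb', h⟩
  induction h with
  | rel x y h =>
    obtain ⟨d, hd, h⟩ := h
    exact .inr ⟨d, hd, .rel _ _ ⟨d, le_rfl, h⟩⟩
  | refl x => exact .inl rfl
  | symm x y _ ih => exact ih.imp Eq.symm fun ⟨b, hb, h⟩ => ⟨b, hb, h.symm⟩
  | trans x y z _ _ ihxy ihyz =>
    rcases ihxy with rfl | ⟨b, hb, hxy⟩
    · exact ihyz
    rcases ihyz with rfl | ⟨b', hb', hyz⟩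
    · exact .inr ⟨b, hb, hxy⟩
    rcases le_total b b' with hbb' | hb'b
    · exact .inr ⟨b', hb', .trans _ _ _ (mono hbb' _ _ hxy) hyz⟩
    · exact .inr ⟨b, hb, .trans _ _ _ hxy (mono hb'b _ _ hyz)⟩

variable [WellFoundedLT O]

theorem LocallyDecreasing.projects (hr : LocallyDecreasing r) (c : O) : Projects r c := by
  induction c using WellFoundedLT.induction with
  | _ c ih =>
  intro a₁ a₂ hca₁ hca₂ x₁ x₂ t₁ t₂ hx ht₁ ht₂
  rcases eq_or_exists_eqvGen_le hx with rfl | ⟨b, hbc, hx⟩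
  · exact ⟨x₁, .refl, .refl, ht₁, ht₂⟩
  have hb : Projects r b := ih b hbc
  obtain ⟨v, hx₁v, hx₂v⟩ := hb.join_stepModulo hr hx
  obtain ⟨w₁, hxw₁, hw₁v, hwt₁⟩ := hb.along_reflTransGen_stepModulo hr hbc hca₁ hx₁v ht₁
  obtain ⟨w₂, hxw₂, hw₂v, hwt₂⟩ := hb.along_reflTransGen_stepModulo hr hbc hca₂ hx₂v ht₂
  obtain ⟨z, hw₁z, hw₂z, hzt₁, hzt₂⟩ := hb a₁ a₂ (hbc.le.trans hca₁) (hbc.le.trans hca₂)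
    w₁ w₂ t₁ t₂ (hw₁v.trans hw₂v.symm) hwt₁ hwt₂
  exact ⟨z, hxw₁.trans (hw₁z.mono hbc.le), hxw₂.trans (hw₂z.mono hbc.le), hzt₁, hzt₂⟩

theorem LocallyDecreasing.join_of_eqvGen [NoMaxOrder O] (hr : LocallyDecreasing r) {x y : A}
    (h : EqvGen (fun x y => ∃ d, r d x y) x y) :
    Join (ReflTransGen fun x y => ∃ d, r d x y) x y := by
  rcases eq_or_exists_eqvGen_le (p := fun _ => True) (by simpa using h) with
    rfl | ⟨b, -, h⟩
  · exact ⟨x, .refl, .refl⟩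
  obtain ⟨c, hbc⟩ := exists_gt b
  have hxy : ConvBelow r c x y :=
    EqvGen.mono (fun _ _ ⟨d, hdb, h⟩ => ⟨d, hdb.trans_lt hbc, h⟩) _ _ h
  obtain ⟨z, hxz, hyz, -⟩ :=
    hr.projects c c c le_rfl le_rfl x y x y hxy (.refl x) (.refl y)
  have forget : RedBelow r c ≤ ReflTransGen fun x y => ∃ d, r d x y :=
    ReflTransGen.mono fun _ _ ⟨d, _, h⟩ => ⟨d, h⟩
  exact ⟨z, forget _ _ hxz, forget _ _ hyz⟩

end AbstractRewriting

section Terms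

open FirstOrder.Language

variable {L : FirstOrder.Language.{u, v}} {V : Type w}

theorem subst_var (t : L.Term V) : t.subst Term.var = t := by
  induction t with
  | var _ => rfl
  | func f ts ih => exact congrArg (Term.func f) (funext ih)

theorem relabel_subst {α β γ : Type*} (t : L.Term α) (ρ : α → β) (σ : β → L.Term γ) :
    (t.relabel ρ).subst σ = t.subst fun y => σ (ρ y) := by
  induction t with
  | var _ => rfl
  | func f ts ih => exact congrArg (Term.func f) (funext ih)

theorem substComp_assoc (σ τ θ : V → L.Term V) :
    substComp (substComp σ τ) θ = substComp σ (substComp τ θ) :=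
  funext fun y => subst_subst (σ y) τ θ

theorem subtermAt_nil (t : L.Term V) : subtermAt t [] = some t := by
  cases t <;> rfl

theorem replaceAt_nil (t r : L.Term V) : replaceAt t [] r = r := by
  cases t <;> rfl

theorem exists_ctx_of_subtermAt {t s : L.Term V} {p : List ℕ} (h : subtermAt t p = some s) :
    ∃ C : Ctx L V, C.holePos = p ∧ C.fill s = t := by
  induction p generalizing t with
  | nil =>
    rw [subtermAt_nil] at h
    exact ⟨.hole, rfl, (Option.some.inj h).symm⟩
  | cons i p ih =>
    cases t with
    | var _ => simp [subtermAt] at h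
    | @func l f ts =>
      by_cases hi : i < l
      · simp only [subtermAt, hi, dif_pos] at h
        obtain ⟨C, rfl, hs⟩ := ih h
        exact ⟨.func f ts ⟨i, hi⟩ C, rfl, by simp [Ctx.fill, hs]⟩
      · simp [subtermAt, hi] at h

theorem subtermAt_relabel {t s : L.Term V} {p : List ℕ} (h : subtermAt t p = some s)
    (ρ : V → V) : subtermAt (t.relabel ρ) p = some (s.relabel ρ) := by
  have relabel_eq_subst : ∀ t : L.Term V, t.relabel ρ = t.subst fun y => .var (ρ y) :=
    fun t => by rw [← relabel_subst t ρ Term.var, subst_var]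
  rw [relabel_eq_subst, relabel_eq_subst]
  exact subtermAt_subst _ _ _ _ h

/-- The number of occurrences of variables and function symbols in a term. -/
def termSize : L.Term V → ℕ
  | .var _ => 1
  | .func _ ts => 1 + ∑ i, termSize (ts i)

theorem termSize_pos (t : L.Term V) : 0 < termSize t := by
  cases t <;> simp only [termSize] <;> omega

theorem termSize_lt_func {l : ℕ} (f : L.Functions l) (ts : Fin l → L.Term V) (i : Fin l) :
    termSize (ts i) < termSize (.func f ts) := by
  have h := Finset.single_le_sum (f := fun i => termSize (ts i)) (fun _ _ => Nat.zero_le _)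
    (Finset.mem_univ i)
  simp only [termSize]
  omega

end Terms

section Unification

open FirstOrder.Language

variable {L : FirstOrder.Language.{u, v}} {V : Type w} {μ τ : V → L.Term V}
  {E : List (L.Term V × L.Term V)}

/-- The substitution `τ` solves the unification problem `E`, a list of equations. -/
def Unifies (τ : V → L.Term V) (E : List (L.Term V × L.Term V)) : Prop :=
  ∀ e ∈ E, e.1.subst τ = e.2.subst τ

/-- `μ` is an idempotent most general unifier of `E`. Idempotence means that a unifier `τ`, which
factors through `μ`, does so with `τ` itself as the other factor. -/
def IsIdempotentMGU (μ : V → L.Term V) (E : List (L.Term V × L.Term V)) : Prop :=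
  Unifies μ E ∧ ∀ τ, Unifies τ E → substComp μ τ = τ

/-- The size of the instance under `τ` of the left-hand sides of `E`. It is the termination measure
of unification if `τ` is a unifier of `E`. -/
def instSize (τ : V → L.Term V) (E : List (L.Term V × L.Term V)) : ℕ :=
  (E.map fun e => termSize (e.1.subst τ)).sum

theorem unifies_cons {s t : L.Term V} :
    Unifies τ ((s, t) :: E) ↔ s.subst τ = t.subst τ ∧ Unifies τ E :=
  List.forall_mem_cons

theorem unifies_map_subst {σ : V → L.Term V} :
    Unifies τ (E.map fun e => (e.1.subst σ, e.2.subst σ)) ↔ Unifies (substComp σ τ) E := by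
  simp only [Unifies, List.forall_mem_map, subst_subst]

theorem unifies_cons_func {l : ℕ} {f : L.Functions l} {ss ts : Fin l → L.Term V} :
    Unifies τ ((.func f ss, .func f ts) :: E) ↔
      Unifies τ (List.ofFn (fun i => (ss i, ts i)) ++ E) := by
  simp only [Unifies, List.forall_mem_cons, List.forall_mem_append, List.forall_mem_ofFn_iff,
    Term.subst, Term.func.injEq, heq_eq_eq, true_and, funext_iff]

theorem instSize_cons {s t : L.Term V} :
    instSize τ ((s, t) :: E) = termSize (s.subst τ) + instSize τ E := by
  simp only [instSize, List.map_cons, List.sum_cons]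

theorem instSize_map_subst {σ : V → L.Term V} :
    instSize τ (E.map fun e => (e.1.subst σ, e.2.subst σ)) = instSize (substComp σ τ) E := by
  simp only [instSize, List.map_map, Function.comp_def, subst_subst]

theorem instSize_ofFn_append {l : ℕ} {f : L.Functions l} {ss ts : Fin l → L.Term V}
    {t : L.Term V} :
    instSize τ (List.ofFn (fun i => (ss i, ts i)) ++ E) < instSize τ ((.func f ss, t) :: E) := by
  simp only [instSize, List.map_append, List.sum_append, List.map_ofFn, List.sum_ofFn,
    List.map_cons, List.sum_cons, Term.subst, termSize, Function.comp_def]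
  omega

theorem IsIdempotentMGU.congr {E' : List (L.Term V × L.Term V)} (hμ : IsIdempotentMGU μ E)
    (hEE' : ∀ τ, Unifies τ E ↔ Unifies τ E') : IsIdempotentMGU μ E' :=
  ⟨(hEE' μ).1 hμ.1, fun τ hτ => hμ.2 τ ((hEE' τ).2 hτ)⟩

theorem isIdempotentMGU_nil : IsIdempotentMGU (Term.var : V → L.Term V) [] :=
  ⟨List.forall_mem_nil _, fun _ _ => rfl⟩

section Elimination

variable [DecidableEq V] {y : V} {t : L.Term V}

theorem substComp_update_var (h : τ y = t.subst τ) :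
    substComp (Function.update Term.var y t) τ = τ := by
  funext z
  rcases eq_or_ne z y with rfl | hzy
  · simp only [substComp, Function.update_self, h]
  · simp only [substComp, Function.update_of_ne hzy, Term.subst]

theorem subst_update_var_of_termSize_le {u : L.Term V}
    (hle : termSize (t.subst τ) ≤ termSize (τ y)) (hty : t ≠ .var y) :
    t.subst (Function.update Term.var y u) = t := by
  induction t with
  | var z => exact Function.update_of_ne (fun hzy => hty (congrArg Term.var hzy)) _ _
  | func f ts ih =>
    refine congrArg (Term.func f) (funext fun i => ?_)
    have hlt : termSize ((ts i).subst τ) < termSize (τ y) :=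
      (termSize_lt_func f (fun i => (ts i).subst τ) i).trans_le hle
    refine ih i hlt.le fun hi => ?_
    rw [hi] at hlt
    exact hlt.false

theorem IsIdempotentMGU.cons_var (ht : t.subst (Function.update Term.var y t) = t)
    (hμ : IsIdempotentMGU μ (E.map fun e => (e.1.subst (Function.update Term.var y t),
      e.2.subst (Function.update Term.var y t)))) :
    IsIdempotentMGU (substComp (Function.update Term.var y t) μ) ((.var y, t) :: E) := by
  refine ⟨unifies_cons.2 ⟨?_, unifies_map_subst.1 hμ.1⟩, fun τ hτ => ?_⟩
  · rw [← subst_subst t, ht]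
    simp only [Term.subst, substComp, Function.update_self]
  · obtain ⟨hy, hE⟩ := unifies_cons.1 hτ
    have hτ' : substComp (Function.update Term.var y t) τ = τ := substComp_update_var hy
    rw [substComp_assoc, hμ.2 τ (unifies_map_subst.2 (hτ'.symm ▸ hE)), hτ']

end Elimination

theorem Unifies.exists_isIdempotentMGU_cons_var {y : V} {t : L.Term V}
    (hτ : Unifies τ ((.var y, t) :: E))
    (ih : ∀ E', Unifies τ E' → instSize τ E' ≤ instSize τ E → ∃ μ, IsIdempotentMGU μ E') :
    ∃ μ, IsIdempotentMGU μ ((.var y, t) :: E) := by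
  classical
  obtain ⟨hy, hE⟩ := unifies_cons.1 hτ
  by_cases hty : t = .var y
  · obtain ⟨μ, hμ⟩ := ih E hE le_rfl
    exact ⟨μ, hμ.congr fun τ => by simp [unifies_cons, hty]⟩
  · have hτ' : substComp (Function.update Term.var y t) τ = τ := substComp_update_var hy
    have hsize : termSize (t.subst τ) ≤ termSize (τ y) := (congrArg termSize hy).ge
    obtain ⟨μ, hμ⟩ := ih _ (unifies_map_subst.2 (hτ'.symm ▸ hE))
      (instSize_map_subst.trans (by rw [hτ'])).le
    exact ⟨_, hμ.cons_var (subst_update_var_of_termSize_le hsize hty)⟩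

/- By recursion on the size of the instance of the problem under the given unifier: eliminating a
variable may enlarge the problem, but it does not change this instance. -/
theorem Unifies.exists_isIdempotentMGU (hτ : Unifies τ E) : ∃ μ, IsIdempotentMGU μ E := by
  induction hn : instSize τ E using Nat.strong_induction_on generalizing E with
  | _ n ih =>
  subst hn
  have ih_tail : ∀ s t E₀, E = (s, t) :: E₀ → ∀ E', Unifies τ E' →
      instSize τ E' ≤ instSize τ E₀ → ∃ μ, IsIdempotentMGU μ E' := by
    rintro s t E₀ rfl E' hE' hle
    have := termSize_pos (s.subst τ)
    exact ih _ (by rw [instSize_cons]; omega) hE' rfl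
  match E with
  | [] => exact ⟨Term.var, isIdempotentMGU_nil⟩
  | (.var y, t) :: E => exact hτ.exists_isIdempotentMGU_cons_var (ih_tail _ _ _ rfl)
  | (.func f ss, .var y) :: E =>
    have swap : ∀ τ, Unifies τ ((.var y, .func f ss) :: E) ↔
        Unifies τ ((.func f ss, .var y) :: E) := fun τ => by
      rw [unifies_cons, unifies_cons, eq_comm]
    obtain ⟨μ, hμ⟩ := ((swap τ).2 hτ).exists_isIdempotentMGU_cons_var (ih_tail _ _ _ rfl)
    exact ⟨μ, hμ.congr swap⟩
  | (@Term.func _ _ l f ss, @Term.func _ _ k g ts) :: E =>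
    have hfg := (unifies_cons.1 hτ).1
    simp only [Term.subst, Term.func.injEq] at hfg
    obtain ⟨rfl, hfg, -⟩ := hfg
    obtain rfl := eq_of_heq hfg
    obtain ⟨μ, hμ⟩ := ih _ instSize_ofFn_append (unifies_cons_func.1 hτ) rfl
    exact ⟨μ, hμ.congr fun τ => unifies_cons_func.symm⟩

theorem exists_isMGU {s t : L.Term V} (hτ : s.subst τ = t.subst τ) : ∃ μ, IsMGU μ s t := by
  have unifies_singleton : ∀ τ, Unifies τ [(s, t)] ↔ s.subst τ = t.subst τ :=
    fun τ => List.forall_mem_singleton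
  obtain ⟨μ, hμ, hmgu⟩ := ((unifies_singleton τ).2 hτ).exists_isIdempotentMGU
  exact ⟨μ, (unifies_singleton μ).1 hμ,
    fun τ hτ => ⟨τ, (hmgu τ ((unifies_singleton τ).2 hτ)).symm⟩⟩

end Unification

section CriticalPeaks

open FirstOrder.Language Function

variable {L : FirstOrder.Language.{u, v}} {V : Type w} {R : Set (Rule L V)}

theorem Step.rewrites (e : Step R) : Rewrites R e.source e.target := by
  obtain ⟨C, hpos, hsource⟩ := exists_ctx_of_subtermAt e.source_at
  have htarget : e.target = C.fill (e.rule.rhs.subst e.sub) := by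
    rw [Step.target, ← hsource, ← hpos, ← List.append_nil C.holePos, replaceAt_fill, replaceAt_nil]
  rw [htarget, ← hsource]
  exact .ctx C (.subst _ (.rule _ e.rule_mem))

theorem Rewrites.exists_step {s t : L.Term V} (h : Rewrites R s t) :
    ∃ e : Step R, e.source = s ∧ e.target = t := by
  induction h with
  | rule r hr =>
    refine ⟨⟨r.lhs, [], r, Term.var, hr, ?_⟩, rfl, ?_⟩
    · rw [subtermAt_nil, subst_var]
    · rw [Step.target, replaceAt_nil, subst_var]
  | subst σ _ ih =>
    obtain ⟨e, rfl, rfl⟩ := ih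
    exact ⟨e.inst .hole σ, rfl, e.inst_target .hole σ⟩
  | ctx C _ ih =>
    obtain ⟨e, rfl, rfl⟩ := ih
    refine ⟨e.inst C Term.var, congrArg C.fill (subst_var _), ?_⟩
    rw [e.inst_target, subst_var]

attribute [ext] LocalPeak

namespace LocalPeak

/-- The mirror image of a local peak. -/
def swap (P : LocalPeak R) : LocalPeak R where
  left := P.right
  right := P.left
  source_eq := P.source_eq.symm

/-- The instance of a local peak under a context and a substitution. -/
def inst (P : LocalPeak R) (C : Ctx L V) (σ : V → L.Term V) : LocalPeak R where
  left := P.left.inst C σ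
  right := P.right.inst C σ
  source_eq := by simp only [Step.inst, P.source_eq]

/-- The peak that arises from an instance `l₁σ₁` of a left-hand side at position `p` of an instance
`l₂σ₂` of another one: the left step contracts `l₁σ₁`, and the right step `l₂σ₂`. -/
def ofOverlap {r₁ r₂ : Rule L V} (h₁ : r₁ ∈ R) (h₂ : r₂ ∈ R) (σ₁ σ₂ : V → L.Term V) (p : List ℕ)
    (h : subtermAt (r₂.lhs.subst σ₂) p = some (r₁.lhs.subst σ₁)) : LocalPeak R where
  left := ⟨r₂.lhs.subst σ₂, p, r₁, σ₁, h₁, h⟩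
  right := ⟨r₂.lhs.subst σ₂, [], r₂, σ₂, h₂, subtermAt_nil _⟩
  source_eq := rfl

end LocalPeak

theorem exists_injective_disjoint_range (V : Type*) [Infinite V] :
    ∃ ρ₁ ρ₂ : V → V, Injective ρ₁ ∧ Injective ρ₂ ∧ Disjoint (Set.range ρ₁) (Set.range ρ₂) := by
  obtain ⟨ι⟩ : Nonempty (V ⊕ V ≃ V) := by
    rw [← Cardinal.eq, Cardinal.mk_sum, Cardinal.lift_id,
      Cardinal.add_eq_self (Cardinal.aleph0_le_mk V)]
  refine ⟨ι ∘ Sum.inl, ι ∘ Sum.inr, ι.injective.comp Sum.inl_injective,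
    ι.injective.comp Sum.inr_injective, ?_⟩
  rw [Set.range_comp, Set.range_comp, Set.disjoint_image_iff ι.injective]
  exact Set.isCompl_range_inl_range_inr.disjoint

theorem exists_comp_eq_of_disjoint_range {α β γ δ : Type*} [Nonempty δ] {ρ₁ : α → γ} {ρ₂ : β → γ}
    (h₁ : Injective ρ₁) (h₂ : Injective ρ₂) (hdisj : Disjoint (Set.range ρ₁) (Set.range ρ₂))
    (σ₁ : α → δ) (σ₂ : β → δ) :
    ∃ τ : γ → δ, (fun y => τ (ρ₁ y)) = σ₁ ∧ (fun y => τ (ρ₂ y)) = σ₂ := by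
  have hinj : Injective (Sum.elim ρ₁ ρ₂) := h₁.sumElim h₂ fun y z hyz =>
    Set.disjoint_left.1 hdisj ⟨y, rfl⟩ ⟨z, hyz.symm⟩
  obtain ⟨τ, hτ⟩ := (factorsThrough_iff _).1 (hinj.factorsThrough (Sum.elim σ₁ σ₂))
  exact ⟨τ, funext fun y => (congrFun hτ (.inl y)).symm,
    funext fun y => (congrFun hτ (.inr y)).symm⟩

theorem exists_isMGU_relabel [Infinite V] {s t : L.Term V} {σ₁ σ₂ : V → L.Term V}
    (h : s.subst σ₁ = t.subst σ₂) :
    ∃ (ρ₁ ρ₂ : V → V) (μ θ : V → L.Term V), Injective ρ₁ ∧ Injective ρ₂ ∧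
      Disjoint (Set.range ρ₁) (Set.range ρ₂) ∧ IsMGU μ (s.relabel ρ₁) (t.relabel ρ₂) ∧
      substComp (fun y => μ (ρ₁ y)) θ = σ₁ ∧ substComp (fun y => μ (ρ₂ y)) θ = σ₂ := by
  obtain ⟨ρ₁, ρ₂, hρ₁, hρ₂, hdisj⟩ := exists_injective_disjoint_range V
  have : Nonempty (L.Term V) := ⟨s⟩
  obtain ⟨τ, rfl, rfl⟩ := exists_comp_eq_of_disjoint_range hρ₁ hρ₂ hdisj σ₁ σ₂
  have hunif : (s.relabel ρ₁).subst τ = (t.relabel ρ₂).subst τ := by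
    rw [relabel_subst, relabel_subst, h]
  obtain ⟨μ, hμ⟩ := exists_isMGU hunif
  obtain ⟨θ, rfl⟩ := hμ.2 τ hunif
  exact ⟨ρ₁, ρ₂, μ, θ, hρ₁, hρ₂, hdisj, hμ, rfl, rfl⟩

theorem LocalPeak.exists_isCritical_inst_eq [Infinite V] (P : LocalPeak R) {q : List ℕ}
    (hpos : P.left.pos = P.right.pos ++ q) (hq : IsFunPos P.right.rule.lhs q) :
    ∃ (Q : LocalPeak R) (C : Ctx L V) (θ : V → L.Term V), Q.IsCritical ∧ Q.inst C θ = P := by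
  have ⟨_, f, ts, hw⟩ := hq
  obtain ⟨C, hC, hsource⟩ := exists_ctx_of_subtermAt P.right.source_at
  have hoverlap : P.left.rule.lhs.subst P.left.sub = (Term.func f ts).subst P.right.sub := by
    have hleft := P.left.source_at
    rw [P.source_eq, hpos, ← hsource, ← hC, subtermAt_fill, subtermAt_subst _ _ _ _ hw] at hleft
    exact (Option.some.inj hleft).symm
  obtain ⟨ρ₁, ρ₂, μ, θ, hρ₁, hρ₂, hdisj, hμ, hθ₁, hθ₂⟩ := exists_isMGU_relabel hoverlap
  have hunif := hμ.1
  rw [relabel_subst, relabel_subst] at hunif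
  have hsub : subtermAt (P.right.rule.lhs.subst fun y => μ (ρ₂ y)) q =
      some (P.left.rule.lhs.subst fun y => μ (ρ₁ y)) :=
    hunif ▸ subtermAt_subst _ _ _ _ hw
  have hright : C.fill ((P.right.rule.lhs.subst fun y => μ (ρ₂ y)).subst θ) = P.right.source := by
    rw [subst_subst, hθ₂, hsource]
  refine ⟨.ofOverlap P.left.rule_mem P.right.rule_mem _ _ q hsub, C, θ,
    ⟨ρ₁, ρ₂, μ, _, hρ₁, hρ₂, hdisj, hq, subtermAt_relabel hw ρ₂, hμ, rfl, rfl, rfl⟩,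
    LocalPeak.ext (Step.ext ?_ ?_ rfl hθ₁) (Step.ext hright ?_ rfl hθ₂)⟩
  · exact hright.trans P.source_eq.symm
  · exact (congrArg (· ++ q) hC).trans hpos.symm
  · exact (List.append_nil _).trans hC

end CriticalPeaks

section Labelings

open FirstOrder.Language Relation

variable {L : FirstOrder.Language.{u, v}} {V : Type w} {R : Set (Rule L V)} {Λ : Type*}
  {gt ge : Λ → Λ → Prop} {lab : OStep R → Λ} {s t : L.Term V} {c d : List (OStep R)}

namespace OStep

/-- The instance of an oriented step under a context and a substitution. -/
def inst (o : OStep R) (C : Ctx L V) (σ : V → L.Term V) : OStep R :=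
  match o with
  | .fwd e => .fwd (e.inst C σ)
  | .bwd e => .bwd (e.inst C σ)

theorem src_inst (o : OStep R) (C : Ctx L V) (σ : V → L.Term V) :
    (o.inst C σ).src = C.fill (o.src.subst σ) := by
  cases o with
  | fwd e => rfl
  | bwd e => exact e.inst_target C σ

theorem tgt_inst (o : OStep R) (C : Ctx L V) (σ : V → L.Term V) :
    (o.inst C σ).tgt = C.fill (o.tgt.subst σ) := by
  cases o with
  | fwd e => exact e.inst_target C σ
  | bwd e => rfl

end OStep

theorem IsConversion.inst (h : IsConversion R s c t) (C : Ctx L V) (σ : V → L.Term V) :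
    IsConversion R (C.fill (s.subst σ)) (c.map (·.inst C σ)) (C.fill (t.subst σ)) := by
  induction h with
  | nil s => exact .nil _
  | cons o _ ih =>
    rw [← o.tgt_inst C σ] at ih
    rw [← o.src_inst C σ]
    exact .cons _ ih

theorem IsForwardOpt.inst (h : IsForwardOpt R s c t) (C : Ctx L V) (σ : V → L.Term V) :
    IsForwardOpt R (C.fill (s.subst σ)) (c.map (·.inst C σ)) (C.fill (t.subst σ)) := by
  rcases h with ⟨rfl, rfl⟩ | ⟨e, rfl, rfl, rfl⟩
  · exact .inl ⟨rfl, rfl⟩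
  · exact .inr ⟨e.inst C σ, rfl, rfl, e.inst_target C σ⟩

theorem IsBackwardOpt.inst (h : IsBackwardOpt R s c t) (C : Ctx L V) (σ : V → L.Term V) :
    IsBackwardOpt R (C.fill (s.subst σ)) (c.map (·.inst C σ)) (C.fill (t.subst σ)) := by
  rcases h with ⟨rfl, rfl⟩ | ⟨e, rfl, rfl, rfl⟩
  · exact .inl ⟨rfl, rfl⟩
  · exact .inr ⟨e.inst C σ, rfl, e.inst_target C σ, rfl⟩

theorem labels_subset_below_iff {r : Λ → Λ → Prop} :
    labels lab c ⊆ below r (labels lab d) ↔ ∀ o ∈ c, ∃ o' ∈ d, r (lab o') (lab o) := by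
  simp only [labels, below, Set.subset_def, Set.mem_ofPred_eq, forall_exists_index, and_imp,
    forall_apply_eq_imp_iff₂, exists_exists_and_eq_and]

theorem labels_map_subset_below {Λ' : Type*} {lab' : OStep R → Λ'} {r : Λ → Λ → Prop}
    {r' : Λ' → Λ' → Prop} {f : OStep R → OStep R}
    (hf : ∀ o o', r (lab o) (lab o') → r' (lab' (f o)) (lab' (f o')))
    (h : labels lab c ⊆ below r (labels lab d)) :
    labels lab' (c.map f) ⊆ below r' (labels lab' (d.map f)) := by
  rw [labels_subset_below_iff] at h ⊢
  rw [List.forall_mem_map]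
  intro o ho
  obtain ⟨o', ho', ho'o⟩ := h o ho
  exact ⟨f o', List.mem_map_of_mem ho', hf o' o ho'o⟩

namespace IsLabeling

theorem gt_lab_inst (hlab : IsLabeling gt ge lab) (C : Ctx L V) (σ : V → L.Term V)
    (o₁ o₂ : OStep R) (h : gt (lab o₁) (lab o₂)) :
    gt (lab (o₁.inst C σ)) (lab (o₂.inst C σ)) := by
  cases o₁ <;> cases o₂ <;> simp only [OStep.inst, ← hlab.fwd_eq_bwd] at h ⊢ <;>
    exact hlab.gt_inst _ _ C σ h

theorem ge_lab_inst (hlab : IsLabeling gt ge lab) (C : Ctx L V) (σ : V → L.Term V)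
    (o₁ o₂ : OStep R) (h : ge (lab o₁) (lab o₂)) :
    ge (lab (o₁.inst C σ)) (lab (o₂.inst C σ)) := by
  cases o₁ <;> cases o₂ <;> simp only [OStep.inst, ← hlab.fwd_eq_bwd] at h ⊢ <;>
    exact hlab.ge_inst _ _ C σ h

end IsLabeling

namespace LocalPeak

variable {P : LocalPeak R}

theorem IsELD.inst (hP : P.IsELD gt ge lab) (hlab : IsLabeling gt ge lab) (C : Ctx L V)
    (σ : V → L.Term V) : (P.inst C σ).IsELD gt ge lab := by
  obtain ⟨t', t'', u'', u', c₁, c₂, c₃, c₄, c₅, h₁, h₂, h₃, h₄, h₅, l₁, l₂, l₃, l₄, l₅⟩ := hP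
  have hgt := hlab.gt_lab_inst C σ
  have hge := hlab.ge_lab_inst C σ
  exact ⟨_, _, _, _, _, _, _, _, _, P.left.inst_target C σ ▸ h₁.inst C σ, h₂.inst C σ,
    h₃.inst C σ, h₄.inst C σ, P.right.inst_target C σ ▸ h₅.inst C σ,
    labels_map_subset_below hgt l₁, labels_map_subset_below hge l₂,
    labels_map_subset_below hgt l₃, labels_map_subset_below hge l₄,
    labels_map_subset_below hgt l₅⟩

theorem IsELD.map {Λ' : Type*} {gt' ge' : Λ' → Λ' → Prop} {φ : Λ → Λ'}
    (hP : P.IsELD gt ge lab) (hgt : ∀ α β, gt α β → gt' (φ α) (φ β))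
    (hge : ∀ α β, ge α β → ge' (φ α) (φ β)) : P.IsELD gt' ge' (φ ∘ lab) := by
  have map_labels : ∀ {r : Λ → Λ → Prop} {r' : Λ' → Λ' → Prop} {c d : List (OStep R)},
      (∀ α β, r α β → r' (φ α) (φ β)) → labels lab c ⊆ below r (labels lab d) →
      labels (φ ∘ lab) c ⊆ below r' (labels (φ ∘ lab) d) := fun hr h => by
    simpa only [List.map_id] using
      labels_map_subset_below (lab' := φ ∘ lab) (f := id) (fun _ _ => hr _ _) h
  obtain ⟨t', t'', u'', u', c₁, c₂, c₃, c₄, c₅, h₁, h₂, h₃, h₄, h₅, l₁, l₂, l₃, l₄, l₅⟩ := hP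
  exact ⟨t', t'', u'', u', c₁, c₂, c₃, c₄, c₅, h₁, h₂, h₃, h₄, h₅, map_labels hgt l₁,
    map_labels hge l₂, map_labels hgt l₃, map_labels hge l₄, map_labels hgt l₅⟩

theorem isELD_or_isELD_swap [Infinite V] (hlab : IsLabeling gt ge lab)
    (hcomp : IsCompatible gt ge lab)
    (hcrit : ∀ P : LocalPeak R, P.IsCritical → P.IsELD gt ge lab) (P : LocalPeak R) :
    P.IsELD gt ge lab ∨ P.swap.IsELD gt ge lab := by
  have of_prefix : ∀ P : LocalPeak R, P.right.pos <+: P.left.pos → P.IsELD gt ge lab := by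
    rintro P ⟨q, hq⟩
    by_cases hfun : IsFunPos P.right.rule.lhs q
    · obtain ⟨Q, C, θ, hQ, rfl⟩ := P.exists_isCritical_inst_eq hq.symm hfun
      exact (hcrit Q hQ).inst hlab C θ
    · exact hcomp P (.inr ⟨q, hq.symm, hfun⟩)
  by_cases hright : P.right.pos <+: P.left.pos
  · exact .inl (of_prefix P hright)
  by_cases hleft : P.left.pos <+: P.right.pos
  · exact .inr (of_prefix P.swap hleft)
  · exact .inl (hcomp P (.inl ⟨hleft, hright⟩))

end LocalPeak

variable {O : Type*} [LinearOrder O] {φ : OStep R → O}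

/-- The rewrite steps with label at most `a`, as an indexed relation on terms. -/
def StepLE (φ : OStep R → O) (a : O) (s t : L.Term V) : Prop :=
  ∃ e : Step R, e.source = s ∧ e.target = t ∧ φ (.fwd e) ≤ a

theorem IsConversion.convBelow (hφ : ∀ e, φ (.fwd e) = φ (.bwd e)) (h : IsConversion R s c t)
    {a : O} (ha : ∀ o ∈ c, φ o < a) : ConvBelow (StepLE φ) a s t := by
  induction h with
  | nil s => exact .refl s
  | cons o _ ih =>
    rw [List.forall_mem_cons] at ha
    refine .trans ?_ (ih ha.2)
    cases o with
    | fwd e => exact .rel _ _ ⟨_, ha.1, e, rfl, rfl, le_rfl⟩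
    | bwd e => exact .symm (.rel _ _ ⟨_, ha.1, e, rfl, rfl, (hφ e).le⟩)

theorem IsForwardOpt.reflGen (h : IsForwardOpt R s c t) {a : O} (ha : ∀ o ∈ c, φ o ≤ a) :
    ReflGen (StepLE φ a) s t := by
  rcases h with ⟨-, rfl⟩ | ⟨e, rfl, rfl, rfl⟩
  · exact .refl
  · exact .single ⟨e, rfl, rfl, ha _ List.mem_cons_self⟩

theorem IsBackwardOpt.reflGen (hφ : ∀ e, φ (.fwd e) = φ (.bwd e)) (h : IsBackwardOpt R s c t)
    {a : O} (ha : ∀ o ∈ c, φ o ≤ a) : ReflGen (StepLE φ a) t s := by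
  rcases h with ⟨-, rfl⟩ | ⟨e, rfl, rfl, rfl⟩
  · exact .refl
  · exact .single ⟨e, rfl, rfl, (hφ e).trans_le (ha _ List.mem_cons_self)⟩

theorem LocalPeak.IsELD.decreasingJoin {P : LocalPeak R} (hP : P.IsELD (· > ·) (· ≥ ·) φ)
    (hφ : ∀ e, φ (.fwd e) = φ (.bwd e)) {a b : O} (ha : φ (.fwd P.left) ≤ a)
    (hb : φ (.fwd P.right) ≤ b) :
    DecreasingJoin (StepLE φ) a b P.left.target P.right.target := by
  obtain ⟨t', t'', u'', u', c₁, c₂, c₃, c₄, c₅, h₁, h₂, h₃, h₄, h₅, l₁, l₂, l₃, l₄, l₅⟩ := hP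
  rw [hφ] at ha
  simp only [labels_subset_below_iff, List.mem_cons, List.not_mem_nil, or_false,
    exists_eq_or_imp, exists_eq_left] at l₁ l₂ l₃ l₄ l₅
  exact ⟨t', t'', u'', u', h₁.convBelow hφ fun o ho => (l₁ o ho).trans_le ha,
    h₂.reflGen fun o ho => (l₂ o ho).trans hb,
    h₃.convBelow hφ fun o ho => (lt_max_iff.2 (l₃ o ho)).trans_le (max_le_max ha hb),
    h₄.reflGen hφ fun o ho => (l₄ o ho).trans ha,
    h₅.convBelow hφ fun o ho => (l₅ o ho).trans_le hb⟩

theorem confluent_of_isELD_or_isELD_swap [WellFoundedLT O] [NoMaxOrder O]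
    (hφ : ∀ e, φ (.fwd e) = φ (.bwd e))
    (hELD : ∀ P : LocalPeak R,
      P.IsELD (· > ·) (· ≥ ·) φ ∨ P.swap.IsELD (· > ·) (· ≥ ·) φ) : Confluent R := by
  have hdec : LocallyDecreasing (StepLE φ) := by
    rintro a b _ _ _ ⟨e₁, hsource, rfl, ha⟩ ⟨e₂, rfl, rfl, hb⟩
    rcases hELD ⟨e₁, e₂, hsource⟩ with h | h
    · exact h.decreasingJoin hφ ha hb
    · exact (h.decreasingJoin hφ hb ha).symm
  have rewrites_eq : Rewrites R = fun s t => ∃ a, StepLE φ a s t := by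
    ext s t
    constructor
    · intro h
      obtain ⟨e, hs, ht⟩ := h.exists_step
      exact ⟨_, e, hs, ht, le_rfl⟩
    · rintro ⟨_, e, rfl, rfl, -⟩
      exact e.rewrites
  intro s t u hst hsu
  rw [rewrites_eq] at hst hsu ⊢
  exact hdec.join_of_eqvGen
    ((EqvGen.reflTransGen_le_eqvGen _ _ _ hst).symm.trans _ _ _
      (EqvGen.reflTransGen_le_eqvGen _ _ _ hsu))

end Labelings

end Rewriting

theorem mainTheorem3_general {L : FirstOrder.Language.{u, v}} {V : Type w} [Infinite V]
    (R : Set (Rewriting.Rule L V)) {Λ : Type x}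
    (gt ge : Λ → Λ → Prop)
    (gt_wf : WellFounded (fun α β : Λ => gt β α))
    (ge_gt : ∀ α β γ : Λ, ge α β → gt β γ → gt α γ)
    (lab : Rewriting.OStep R → Λ)
    (hlab : Rewriting.IsLabeling gt ge lab)
    (hcomp : Rewriting.IsCompatible gt ge lab)
    (hcrit : ∀ P : Rewriting.LocalPeak R, P.IsCritical → P.IsELD gt ge lab) :
    Rewriting.Confluent R := by
  have : IsWellFounded Λ (fun α β : Λ => gt β α) := ⟨gt_wf⟩
  let rk : Λ → Ordinal.{x} := IsWellFounded.rank (fun α β : Λ => gt β α)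
  have rk_gt : ∀ α β, gt α β → rk α > rk β := fun α β h => IsWellFounded.rank_lt_of_rel h
  have rk_ge : ∀ α β, ge α β → rk α ≥ rk β := fun α β h => by
    rw [ge_iff_le, show rk β = _ from IsWellFounded.rank_eq (fun α β : Λ => gt β α) β]
    exact Ordinal.iSup_le fun γ => Order.succ_le_of_lt (rk_gt α γ (ge_gt α β γ h γ.2))
  refine Rewriting.confluent_of_isELD_or_isELD_swap (φ := rk ∘ lab)
    (fun e => congrArg rk (hlab.fwd_eq_bwd e)) fun P => ?_
  exact (P.isELD_or_isELD_swap hlab hcomp hcrit).imp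
    (fun h => h.map rk_gt rk_ge) (fun h => h.map rk_gt rk_ge)

theorem mainTheorem3 {L : FirstOrder.Language.{u, v}} {V : Type w} [Infinite V]
    (R : Set (Rewriting.Rule L V)) {Λ : Type x}
    (gt ge : Λ → Λ → Prop)
    (gt_trans : ∀ α β γ : Λ, gt α β → gt β γ → gt α γ)
    (gt_wf : WellFounded (fun α β : Λ => gt β α))
    (ge_refl : ∀ α : Λ, ge α α)
    (ge_trans : ∀ α β γ : Λ, ge α β → ge β γ → ge α γ)
    (compat : ∀ α β γ δ : Λ, ge α β → gt β γ → ge γ δ → gt α δ)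
    (lab : Rewriting.OStep R → Λ)
    (hlab : Rewriting.IsLabeling gt ge lab)
    (hcomp : Rewriting.IsCompatible gt ge lab)
    (hcrit : ∀ P : Rewriting.LocalPeak R, P.IsCritical → P.IsELD gt ge lab) :
    Rewriting.Confluent R :=
  mainTheorem3_general R gt ge gt_wf
    (fun α β γ hαβ hβγ => compat α β γ γ hαβ hβγ (ge_refl γ)) lab hlab hcomp hcrit
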